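/- For positive integers $n, r, s$ with $r > s$, let $R(n;r,s)$ be the least positive integer $N$ such that, whenever every edge of the complete graph $K_N$ receives a set of exactly $s$ colors from a palette of $r$ colors, there are $n$ vertices such that all the edges between them receive a common color. There are absolute constants $c, c' > 0$ and positive numbers $a_r, b_r$ depending only on $r$ such that, for all integers $n \ge 3$ and $r > s \ge 1$, $$a_r \cdot 2^{c n \max\left(\frac{r-s}{r}, \frac{(r-s)^3}{r^2}\right)} \le R(n;r,s),$$ $$R(n;r,s) \le 2^{c' n \frac{(r-s)^2}{r} \log\left(\frac{r}{\min(s,r-s)}\right)} \quad\text{if } n(r-s)^2 \ge r \text{ (in particular, if } n \ge r\text{)},$$ and, without this restriction, $R(n;r,s) \le b_r \cdot 2^{c' n \frac{(r-s)^2}{r} \log\left(\frac{r}{\min(s,r-s)}\right)}$. Moreover, $R(n;r,s) = 2^{\Theta(nr)}$ when $s/r$ is bounded away from $0$ and $1$: for every $\varepsilon > 0$ there are $c_1, c_2 > 0$ and a function $n_0 : \mathbb{N} \to \mathbb{N}$ such that, for all integers $n \ge 3$ and $r, s \ge 1$ with $\varepsilon r < s < (1-\varepsilon) r$, one has $R(n;r,s)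 \le 2^{c_2 n r}$, and $R(n;r,s) \ge 2^{c_1 n r}$ if $n \ge n_0(r)$. -/

import Mathlib

/-- An `(r, s)`-coloring of the complete graph `K_N` on the vertex set `Fin N`: every edge receives
a set of exactly `s` colors from the palette `Fin r`. -/
abbrev SetColoring (N r s : ℕ) : Type :=
  SimpleGraph.TopEdgeLabeling (Fin N) {A : Finset (Fin r) // A.card = s}

/-- The coloring `χ` has a monochromatic `n`-clique: `n` distinct vertices such that all the edges
between them receive a common color. -/
def SetColoring.HasMonochromaticClique {N r s : ℕ} (χ : SetColoring N r s) (n : ℕ) : Prop :=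
  ∃ S : Finset (Fin N), S.card = n ∧ ∃ i : Fin r,
    ∀ u ∈ S, ∀ v ∈ S, ∀ h : (⊤ : SimpleGraph (Fin N)).Adj u v, i ∈ (χ.get u v h).1

/-- The set-coloring Ramsey number `R(n; r, s)`: the least positive integer `N` such that every
`(r, s)`-coloring of `K_N` has a monochromatic `n`-clique. -/
noncomputable def setColoringRamsey (n r s : ℕ) : ℕ :=
  sInf {N : ℕ | 0 < N ∧ ∀ χ : SetColoring N r s, χ.HasMonochromaticClique n}

/-! Upper bound. Chasing neighborhoods as in the proof of Ramsey's theorem for `r` colors gives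
`R(n; r, s) ≤ (1 + r / s) ^ (r * n)`, which suffices if `s` is not close to `r`. If `d = r - s` is
small, some color class is so dense that a typical vertex misses only few vertices of a maximum
clique `I`. Among the vertices that miss the same set `J ⊆ I`, a clique larger than `J` could be
swapped for `J` to enlarge `I`, so this color has only small cliques there. Doing this for `2 * d`
colors in turn leaves a vertex set on which they have only small cliques, and chasing neighborhoods
with these `2 * d` colors alone, of which each edge receives at least half, bounds its size.

Lower bound. Let every edge miss one of `ρ` colors chosen at random: for `ρ` small compared with `n`
there are exponentially many vertices without a monochromatic `n`-clique. Replacing each color by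
`r - s` copies, with `ρ` about `r / (r - s)`, gives the exponent `(r - s) / r`. Alternatively, take
the vertices of a coloring with somewhat larger `ρ` as the alphabet of a Reed–Solomon code and use
a separate copy of its palette in each position. Two words agree in few positions, and an edge loses
a whole palette only there, which gives the exponent `(r - s) ^ 3 / r ^ 2`.
-/

section OmittedColors

open Finset

variable {ι V : Type*} {G : ι → SimpleGraph V} {P Q : Finset ι} {W : Finset V} {d : ℕ}

open scoped Classical in
/-- The colors `i` of the palette `P` that the pair `u`, `v` lacks, when the edges of color `i` are
those of the graph `G i`. -/
noncomputable def omittedColors (G : ι → SimpleGraph V) (P : Finset ι) (u v : V) : Finset ι :=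
  {i ∈ P | ¬ (G i).Adj u v}

/-- Every pair of distinct vertices lacks at most `d` colors of the palette `P`. A set coloring is
encoded as the family `G` of its color classes, and an edge with `s` out of `r` colors lacks
`r - s` of them. -/
def OmitsAtMost (G : ι → SimpleGraph V) (P : Finset ι) (d : ℕ) : Prop :=
  ∀ ⦃u v⦄, u ≠ v → #(omittedColors G P u v) ≤ d

open scoped Classical in
/-- The vertices of `W` that are not joined to `u`. As graphs have no loops, `u` is among them if
`u ∈ W`. -/
noncomputable def nonNeighbors (G : SimpleGraph V) (W : Finset V) (u : V) : Finset V :=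
  {v ∈ W | ¬ G.Adj u v}

theorem OmitsAtMost.mono_palette (hG : OmitsAtMost G P d) (hQP : Q ⊆ P) : OmitsAtMost G Q d := by
  classical
  exact fun u v huv ↦ (card_le_card (filter_subset_filter _ hQP)).trans (hG huv)

open scoped Classical in
theorem OmitsAtMost.card_sub_le_card_adj (hG : OmitsAtMost G P d) {u v : V} (huv : u ≠ v) :
    #P - d ≤ #{i ∈ P | (G i).Adj u v} := by
  have hsplit := card_filter_add_card_filter_not (s := P) fun i ↦ (G i).Adj u v
  have homit : #{i ∈ P | ¬ (G i).Adj u v} ≤ d := hG huv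
  omega

theorem sum_card_nonNeighbors_eq_sum_card_omittedColors (G : ι → SimpleGraph V) (P : Finset ι)
    (W : Finset V) (u : V) :
    ∑ i ∈ P, #(nonNeighbors (G i) W u) = ∑ v ∈ W, #(omittedColors G P u v) := by
  classical
  exact sum_card_bipartiteAbove_eq_sum_card_bipartiteBelow fun i v ↦ ¬ (G i).Adj u v

end OmittedColors

section NeighborhoodChasing

open Finset

variable {ι V : Type*} {G : ι → SimpleGraph V} {P : Finset ι} {W : Finset V} {d : ℕ}

theorem cliqueFreeOn_one_iff {H : SimpleGraph V} : H.CliqueFreeOn W 1 ↔ W = ∅ := by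
  refine ⟨fun hW ↦ eq_empty_of_forall_notMem fun v hv ↦ ?_, fun hW ↦ by simp [hW]⟩
  have hv' := hW.subset H (Set.singleton_subset_iff.mpr (mem_coe.mpr hv))
  exact lt_irrefl 1 ((SimpleGraph.cliqueFreeOn_singleton H).mp hv')

open scoped Classical in
theorem cliqueFreeOn_filter_adj {H : SimpleGraph V} {n : ℕ} {v : V} (hv : v ∈ W)
    (hW : H.CliqueFreeOn W (n + 1)) : H.CliqueFreeOn (({w ∈ W | H.Adj v w} : Finset V) : Set V) n :=
  (SimpleGraph.CliqueFreeOn.of_succ H hW hv).subset H fun w hw ↦ by simpa using hw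

open scoped Classical in
theorem OmitsAtMost.exists_le_card_neighbors (hG : OmitsAtMost G P d) (hP : P.Nonempty) {v : V}
    (hv : v ∈ W) :
    ∃ i ∈ P, (#W - 1) * (#P - d) ≤ #P * #{w ∈ W | (G i).Adj v w} := by
  have hcount : (#W - 1) * (#P - d) ≤ ∑ i ∈ P, #{w ∈ W | (G i).Adj v w} := calc
    (#W - 1) * (#P - d) = ∑ _w ∈ W.erase v, (#P - d) := by
      rw [sum_const, card_erase_of_mem hv, smul_eq_mul]
    _ ≤ ∑ w ∈ W.erase v, #{i ∈ P | (G i).Adj v w} :=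
      sum_le_sum fun w hw ↦ hG.card_sub_le_card_adj (ne_of_mem_erase hw).symm
    _ ≤ ∑ w ∈ W, #{i ∈ P | (G i).Adj v w} := sum_le_sum_of_subset (erase_subset v W)
    _ = ∑ i ∈ P, #{w ∈ W | (G i).Adj v w} :=
      (sum_card_bipartiteAbove_eq_sum_card_bipartiteBelow fun i w ↦ (G i).Adj v w).symm
  by_contra! hlt
  have hsum := sum_lt_sum_of_nonempty hP hlt
  rw [← mul_sum, sum_const, smul_eq_mul] at hsum
  exact (Nat.lt_of_mul_lt_mul_left hsum).not_ge hcount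

open scoped Classical in
theorem OmitsAtMost.card_lt_of_forall_card_neighbors_lt (hG : OmitsAtMost G P d) (hd : d < #P)
    {X : ℝ} (hX : 1 ≤ X) (hN : ∀ v ∈ W, ∀ i ∈ P, (#{w ∈ W | (G i).Adj v w} : ℝ) < X) :
    (#W : ℝ) < X * (1 + #P / (#P - d)) := by
  have hP : P.Nonempty := card_pos.mp (by omega)
  have hσ : (0 : ℝ) < #P - d := sub_pos.mpr (by exact_mod_cast hd)
  obtain rfl | ⟨v, hv⟩ := W.eq_empty_or_nonempty
  · rw [card_empty, Nat.cast_zero]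
    positivity
  obtain ⟨i, hi, hvi⟩ := hG.exists_le_card_neighbors hP hv
  have hvi' : ((#W : ℝ) - 1) * (#P - d) ≤ #P * #{w ∈ W | (G i).Adj v w} := by
    have h := (Nat.cast_le (α := ℝ)).mpr hvi
    push_cast [Nat.cast_sub hd.le, Nat.cast_sub (card_pos.mpr ⟨v, hv⟩)] at h
    exact h
  have hlt : (#P : ℝ) * #{w ∈ W | (G i).Adj v w} < #P * X :=
    mul_lt_mul_of_pos_left (hN v hv i hi) (by exact_mod_cast hP.card_pos)
  refine lt_of_mul_lt_mul_right ?_ hσ.le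
  calc (#W : ℝ) * (#P - d) = (#W - 1) * (#P - d) + (#P - d) := by ring
    _ < #P * X + X * (#P - d) :=
      add_lt_add_of_lt_of_le (hvi'.trans_lt hlt) (le_mul_of_one_le_left hσ.le hX)
    _ = X * (1 + #P / (#P - d)) * (#P - d) := by field_simp; ring

theorem OmitsAtMost.card_lt_pow_of_cliqueFreeOn (hG : OmitsAtMost G P d) (hd : d < #P)
    {t : ι → ℕ} (ht : ∀ i ∈ P, (G i).CliqueFreeOn W (t i + 1)) :
    (#W : ℝ) < (1 + #P / (#P - d)) ^ ∑ i ∈ P, t i := by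
  classical
  obtain ⟨T, hT⟩ : ∃ T, ∑ i ∈ P, t i = T := ⟨_, rfl⟩
  rw [hT]
  induction T generalizing t W with
  | zero =>
    obtain ⟨i, hi⟩ : P.Nonempty := card_pos.mp (by omega)
    have hW := ht i hi
    rw [sum_eq_zero_iff.mp hT i hi, cliqueFreeOn_one_iff] at hW
    simp [hW]
  | succ T ih =>
    have hσ : (0 : ℝ) < #P - d := sub_pos.mpr (by exact_mod_cast hd)
    rw [pow_succ]
    refine hG.card_lt_of_forall_card_neighbors_lt hd
      (one_le_pow₀ (le_add_of_nonneg_right (by positivity))) fun v hv i hi ↦ ?_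
    have hti : t i ≠ 0 := fun h0 ↦ by
      have hW := ht i hi
      rw [h0, cliqueFreeOn_one_iff] at hW
      exact notMem_empty v (hW ▸ hv)
    refine ih (t := Function.update t i (t i - 1)) (fun j hj ↦ ?_) ?_
    · obtain rfl | hji := eq_or_ne j i
      · rw [Function.update_self, Nat.sub_one_add_one hti]
        exact cliqueFreeOn_filter_adj hv (ht j hj)
      · rw [Function.update_of_ne hji]
        exact (ht j hj).subset (G j) (coe_subset.mpr (filter_subset _ W))
    · have hsum := add_sum_erase P t hi
      rw [sum_update_of_mem hi, sdiff_singleton_eq_erase]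
      omega

theorem OmitsAtMost.card_lt_pow_of_cliqueFree [Fintype ι] [Fintype V] {n : ℕ}
    (hG : OmitsAtMost G univ d) (hd : d < Fintype.card ι) (hn : 1 ≤ n)
    (hfree : ∀ i, (G i).CliqueFree n) :
    (Fintype.card V : ℝ) <
      (1 + Fintype.card ι / (Fintype.card ι - d)) ^ (Fintype.card ι * (n - 1)) := by
  have hlt := hG.card_lt_pow_of_cliqueFreeOn (W := univ) (t := fun _ ↦ n - 1) hd fun i _ ↦ by
    rw [Nat.sub_add_cancel hn]
    exact (hfree i).cliqueFreeOn
  simpa only [card_univ, sum_const, smul_eq_mul] using hlt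

end NeighborhoodChasing

section ColorClasses

open Finset

variable {ι V : Type*} {G : ι → SimpleGraph V} {N n r s d : ℕ}

/-- The graph formed by the edges whose color set contains `i`. -/
def SetColoring.colorGraph (χ : SetColoring N r s) (i : Fin r) : SimpleGraph (Fin N) where
  Adj u v := ∃ h : (⊤ : SimpleGraph (Fin N)).Adj u v, i ∈ (χ.get u v h).1
  symm := ⟨fun u v ⟨h, hi⟩ ↦ ⟨h.symm, by rwa [SimpleGraph.EdgeLabeling.get_comm]⟩⟩
  loopless := ⟨fun _ ⟨h, _⟩ ↦ h.ne rfl⟩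

theorem SetColoring.hasMonochromaticClique_iff (χ : SetColoring N r s) :
    χ.HasMonochromaticClique n ↔ ∃ i, ¬ (χ.colorGraph i).CliqueFree n := by
  simp only [SimpleGraph.CliqueFree, not_forall, not_not]
  constructor
  · rintro ⟨S, hS, i, hi⟩
    exact ⟨i, S, fun u hu v hv huv ↦ ⟨huv, hi u hu v hv huv⟩, hS⟩
  · rintro ⟨i, S, hclique, hS⟩
    exact ⟨S, hS, i, fun u hu v hv h ↦ (hclique hu hv h.ne).2⟩

theorem SetColoring.omitsAtMost_colorGraph (χ : SetColoring N r s) :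
    OmitsAtMost χ.colorGraph univ (r - s) := by
  classical
  intro u v huv
  have hadj : (⊤ : SimpleGraph (Fin N)).Adj u v := huv
  have homit : omittedColors χ.colorGraph univ u v = univ \ (χ.get u v hadj).1 := by
    ext i
    simp [omittedColors, SetColoring.colorGraph, huv]
  rw [homit, card_sdiff_of_subset (subset_univ _), card_univ, Fintype.card_fin,
    (χ.get u v hadj).2]

theorem setColoringRamsey_le_add_one {B : ℝ} (hB : 0 ≤ B)
    (h : ∀ {N : ℕ} (G : Fin r → SimpleGraph (Fin N)), OmitsAtMost G univ (r - s) →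
      (∀ i, (G i).CliqueFree n) → (N : ℝ) ≤ B) :
    (setColoringRamsey n r s : ℝ) ≤ B + 1 := by
  obtain h2 | h2 := Nat.lt_or_ge (setColoringRamsey n r s) 2
  · have hle : (setColoringRamsey n r s : ℝ) ≤ 1 := by exact_mod_cast Nat.lt_succ_iff.mp h2
    linarith
  · have hlt : setColoringRamsey n r s - 1 < setColoringRamsey n r s := by omega
    have hnot := Nat.notMem_of_lt_sInf hlt
    simp only [Set.mem_ofPred_eq, not_and, not_forall] at hnot
    obtain ⟨χ, hχ⟩ := hnot (by omega)
    rw [χ.hasMonochromaticClique_iff, not_exists_not] at hχ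
    have hle := h χ.colorGraph χ.omitsAtMost_colorGraph hχ
    rwa [Nat.cast_pred (by omega), sub_le_iff_le_add] at hle

open scoped Classical in
theorem exists_setColoring_colorGraph_le (H : Fin r → SimpleGraph (Fin N))
    (hH : ∀ u v, u ≠ v → s ≤ #{i | (H i).Adj u v}) :
    ∃ χ : SetColoring N r s, ∀ i, χ.colorGraph i ≤ H i := by
  have hsub : ∀ e : (⊤ : SimpleGraph (Fin N)).edgeSet,
      ∃ A ⊆ ({i | e.1 ∈ (H i).edgeSet} : Finset (Fin r)), #A = s := by
    rintro ⟨⟨u, v⟩, huv⟩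
    exact exists_subset_card_eq (hH u v huv)
  choose A hAH hA using hsub
  refine ⟨fun e ↦ ⟨A e, hA e⟩, fun i u v ⟨huv, hi⟩ ↦ ?_⟩
  exact (mem_filter.mp (hAH _ hi)).2

theorem natCast_lt_pow_of_omitsAtMost {G : Fin r → SimpleGraph (Fin N)} (hs : 1 ≤ s) (hsr : s ≤ r)
    (hG : OmitsAtMost G univ (r - s)) (hn : 1 ≤ n) (hfree : ∀ i, (G i).CliqueFree n) :
    (N : ℝ) < (1 + r / s) ^ (r * (n - 1)) := by
  have hlt := hG.card_lt_pow_of_cliqueFree (by rw [Fintype.card_fin]; omega) hn hfree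
  rwa [Fintype.card_fin, Fintype.card_fin, Nat.cast_sub hsr, sub_sub_cancel] at hlt

theorem exists_forall_hasMonochromaticClique (hn : 1 ≤ n) (hs : 1 ≤ s) (hsr : s ≤ r) :
    ∃ N, 0 < N ∧ ∀ χ : SetColoring N r s, χ.HasMonochromaticClique n := by
  obtain ⟨N, hN⟩ := exists_nat_gt ((1 + r / s : ℝ) ^ (r * (n - 1)))
  refine ⟨N, by exact_mod_cast (show (0 : ℝ) ≤ _ by positivity).trans_lt hN, fun χ ↦ ?_⟩
  by_contra hχ
  rw [χ.hasMonochromaticClique_iff, not_exists_not] at hχ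
  exact hN.not_gt (natCast_lt_pow_of_omitsAtMost hs hsr χ.omitsAtMost_colorGraph hn hχ)

theorem setColoringRamsey_le_pow (hn : 1 ≤ n) (hs : 1 ≤ s) (hsr : s ≤ r) :
    (setColoringRamsey n r s : ℝ) ≤ (1 + r / s) ^ (r * n) := by
  have hρ : (2 : ℝ) ≤ 1 + r / s := by
    have : (1 : ℝ) ≤ r / s := (one_le_div₀ (by exact_mod_cast hs)).mpr (by exact_mod_cast hsr)
    linarith
  have hone : (1 : ℝ) ≤ (1 + r / s) ^ (r * (n - 1)) := one_le_pow₀ (by linarith)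
  calc (setColoringRamsey n r s : ℝ) ≤ (1 + r / s) ^ (r * (n - 1)) + 1 :=
        setColoringRamsey_le_add_one (by positivity) fun G hG hfree ↦
          (natCast_lt_pow_of_omitsAtMost hs hsr hG hn hfree).le
    _ ≤ (1 + r / s) ^ (r * (n - 1)) * (1 + r / s) := by nlinarith
    _ = (1 + r / s) ^ (r * (n - 1) + 1) := (pow_succ _ _).symm
    _ ≤ (1 + r / s) ^ (r * n) := by
      refine pow_le_pow_right₀ (by linarith) ?_
      obtain ⟨k, rfl⟩ := Nat.exists_eq_add_of_le' hn
      rw [Nat.add_sub_cancel, mul_add_one]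
      omega

theorem card_lt_setColoringRamsey [Fintype ι] [Fintype V] (hG : OmitsAtMost G univ d)
    (hfree : ∀ i, (G i).CliqueFree n) (hn : 1 ≤ n) (hs : 1 ≤ s) (hr : Fintype.card ι ≤ r)
    (hd : s + d ≤ Fintype.card ι) : Fintype.card V < setColoringRamsey n r s := by
  classical
  by_contra! hle
  obtain ⟨-, hmono⟩ := Nat.sInf_mem (exists_forall_hasMonochromaticClique hn hs (by omega : s ≤ r))
  obtain ⟨g⟩ := Function.Embedding.nonempty_of_card_le
    ((Fintype.card_fin (setColoringRamsey n r s)).trans_le hle)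
  obtain ⟨e⟩ := Function.Embedding.nonempty_of_card_le (hr.trans_eq (Fintype.card_fin r).symm)
  have : Nonempty ι := Fintype.card_pos_iff.mp (by omega)
  obtain ⟨χ, hχ⟩ := exists_setColoring_colorGraph_le (s := s)
    (fun i ↦ (G (Function.invFun e i)).comap g) fun u v huv ↦ by
      have hcard := hG.card_sub_le_card_adj (g.injective.ne huv)
      rw [card_univ] at hcard
      calc s ≤ #({i | (G i).Adj (g u) (g v)} : Finset ι) := by omega
        _ ≤ _ := card_le_card_of_injOn e (fun i hi ↦ by
          simpa [Function.leftInverse_invFun e.injective i] using hi) e.injective.injOn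
  obtain ⟨i, hi⟩ := χ.hasMonochromaticClique_iff.mp (hmono χ)
  exact hi (((hfree _).comap (SimpleGraph.Embedding.comap g _).isContained).anti (hχ i))

end ColorClasses

section Swapping

open Finset

variable {V : Type*} {G : SimpleGraph V} {I W : Finset V} {n m : ℕ} {x : ℝ}

theorem card_le_two_mul_card_filter_lt {α : Type*} {s : Finset α} {g : α → ℝ} {M : ℝ} (hM : 0 < M)
    (hg : ∀ a ∈ s, 0 ≤ g a) (hsum : 2 * ∑ a ∈ s, g a ≤ M * #s) :
    (#s : ℝ) ≤ 2 * #{a ∈ s | g a < M} := by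
  have hmarkov : (#{a ∈ s | ¬ g a < M} : ℝ) * M ≤ ∑ a ∈ s, g a := calc
    (#{a ∈ s | ¬ g a < M} : ℝ) * M ≤ ∑ a ∈ s with ¬ g a < M, g a := by
      rw [← nsmul_eq_mul]
      exact card_nsmul_le_sum _ _ _ fun a ha ↦ not_lt.mp (mem_filter.mp ha).2
    _ ≤ ∑ a ∈ s, g a := sum_le_sum_of_subset_of_nonneg (filter_subset _ _) fun a ha _ ↦ hg a ha
  have hsplit : (#{a ∈ s | g a < M} : ℝ) + #{a ∈ s | ¬ g a < M} = #s := by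
    exact_mod_cast card_filter_add_card_filter_not _
  nlinarith

theorem pow_mul_card_filter_powerset_le {α : Type*} (s : Finset α) (hx : 0 < x) (hx1 : x ≤ 1)
    (m : ℕ) : x ^ m * #{t ∈ s.powerset | #t ≤ m} ≤ (1 + x) ^ #s := calc
  x ^ m * #{t ∈ s.powerset | #t ≤ m} = ∑ t ∈ s.powerset with #t ≤ m, x ^ m := by
    rw [sum_const, nsmul_eq_mul, mul_comm]
  _ ≤ ∑ t ∈ s.powerset with #t ≤ m, x ^ #t :=
    sum_le_sum fun t ht ↦ pow_le_pow_of_le_one hx.le hx1 (mem_filter.mp ht).2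
  _ ≤ ∑ t ∈ s.powerset, x ^ #t :=
    sum_le_sum_of_subset_of_nonneg (filter_subset _ _) fun _ _ _ ↦ by positivity
  _ = (1 + x) ^ #s := by
    rw [add_comm, ← sum_pow_mul_eq_add_pow]
    simp only [one_pow, mul_one]

theorem exists_isClique_cliqueFreeOn_card_add_one (G : SimpleGraph V) (W : Finset V) :
    ∃ I ⊆ W, G.IsClique I ∧ G.CliqueFreeOn W (#I + 1) := by
  classical
  obtain ⟨I, hI, hmax⟩ := exists_max_image
    (W.powerset.filter fun K : Finset V ↦ G.IsClique (K : Set V)) card ⟨∅, by simp⟩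
  simp only [mem_filter, mem_powerset, and_imp] at hI hmax
  refine ⟨I, hI.1, hI.2, fun K hKW hK ↦ ?_⟩
  have hle := hmax K (coe_subset.mp hKW) hK.isClique
  rw [hK.card_eq] at hle
  omega

/- The vertices of `I` outside `J` together with a clique of `U` form a clique, so a large clique of
`U` could be swapped for `J` to enlarge `I`. -/
theorem cliqueFreeOn_card_add_one_of_forall_adj {J U : Finset V} (hI : G.IsClique (I : Set V))
    (hIW : I ⊆ W) (hmax : G.CliqueFreeOn W (#I + 1)) (hJI : J ⊆ I) (hUW : U ⊆ W)
    (hadj : ∀ v ∈ U, ∀ u ∈ I, u ∉ J → G.Adj v u) : G.CliqueFreeOn U (#J + 1) := by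
  classical
  intro K hKU hK
  have hKU' : K ⊆ U := coe_subset.mp hKU
  have hdisj : Disjoint (I \ J) K := disjoint_left.mpr fun u hu huK ↦
    (hadj u (hKU' huK) u (mem_sdiff.mp hu).1 (mem_sdiff.mp hu).2).ne rfl
  have hcard : #(I \ J ∪ K) = #I + 1 := by
    rw [card_union_of_disjoint hdisj, card_sdiff_of_subset hJI, hK.card_eq]
    have := card_le_card hJI
    omega
  refine hmax (t := I \ J ∪ K) ?_ ⟨?_, hcard⟩
  · exact coe_subset.mpr (union_subset (sdiff_subset.trans hIW) (hKU'.trans hUW))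
  · have hadj' : ∀ u ∈ I \ J, ∀ v ∈ K, G.Adj v u := fun u hu v hv ↦
      hadj v (hKU' hv) u (mem_sdiff.mp hu).1 (mem_sdiff.mp hu).2
    intro u hu v hv huv
    rw [mem_coe, mem_union] at hu hv
    obtain hu | hu := hu <;> obtain hv | hv := hv
    · exact hI (sdiff_subset hu) (sdiff_subset hv) huv
    · exact (hadj' u hu v hv).symm
    · exact hadj' v hv u hu
    · exact hK.isClique hu hv huv

theorem sum_card_nonNeighbors_comm (G : SimpleGraph V) (I W : Finset V) :
    ∑ v ∈ W, #(nonNeighbors G I v) = ∑ u ∈ I, #(nonNeighbors G W u) := by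
  classical
  exact (sum_card_bipartiteAbove_eq_sum_card_bipartiteBelow fun v u ↦ ¬ G.Adj v u).trans
    (sum_congr rfl fun u _ ↦ congrArg card (filter_congr fun v _ ↦ not_congr (G.adj_comm v u)))

theorem card_le_two_mul_card_filter_card_nonNeighbors_le {c : ℝ}
    (hc : ∀ u ∈ I, (#(nonNeighbors G W u) : ℝ) ≤ c) (hm : 2 * (#I * c) ≤ (m + 1) * #W) :
    (#W : ℝ) ≤ 2 * #{v ∈ W | #(nonNeighbors G I v) ≤ m} := by
  have hsum : ∑ v ∈ W, (#(nonNeighbors G I v) : ℝ) ≤ #I * c := calc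
    ∑ v ∈ W, (#(nonNeighbors G I v) : ℝ) = ∑ u ∈ I, (#(nonNeighbors G W u) : ℝ) := by
      exact_mod_cast sum_card_nonNeighbors_comm G I W
    _ ≤ #I * c := by
      rw [← nsmul_eq_mul]
      exact sum_le_card_nsmul _ _ _ hc
  have hmarkov := card_le_two_mul_card_filter_lt (s := W)
    (g := fun v ↦ (#(nonNeighbors G I v) : ℝ)) (M := m + 1) (by positivity)
    (fun _ _ ↦ by positivity) (by linarith)
  norm_cast at hmarkov ⊢
  simpa only [Nat.lt_succ_iff] using hmarkov

theorem exists_subset_cliqueFreeOn_of_card_nonNeighbors_le (hfree : G.CliqueFree n) {c : ℝ}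
    (hc0 : 0 ≤ c) (hc : ∀ u ∈ W, (#(nonNeighbors G W u) : ℝ) ≤ c)
    (hm : 2 * (n * c) ≤ (m + 1) * #W) (hx : 0 < x) (hx1 : x ≤ 1) :
    ∃ W' ⊆ W, (#W : ℝ) ≤ 2 * ((1 + x) ^ n / x ^ m) * #W' ∧ G.CliqueFreeOn W' (m + 1) := by
  classical
  obtain ⟨I, hIW, hI, hmax⟩ := exists_isClique_cliqueFreeOn_card_add_one G W
  have hIn : #I ≤ n := by
    by_contra! hlt
    exact hfree.mono hlt.le I ⟨hI, rfl⟩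
  have hmost := card_le_two_mul_card_filter_card_nonNeighbors_le (m := m)
    (fun u hu ↦ hc u (hIW hu)) (hm.trans' (by gcongr))
  set W₁ := {v ∈ W | #(nonNeighbors G I v) ≤ m}
  obtain ⟨J, hJ, hfiber⟩ := exists_le_card_fiber_of_nsmul_le_card_of_maps_to (s := W₁)
    (t := {J ∈ I.powerset | #J ≤ m}) (f := nonNeighbors G I)
    (b := (#W₁ : ℝ) * (x ^ m / (1 + x) ^ n))
    (fun v hv ↦ mem_filter.mpr ⟨mem_powerset.mpr (filter_subset _ _), (mem_filter.mp hv).2⟩)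
    ⟨∅, by simp⟩ (by
      have hpow := (pow_mul_card_filter_powerset_le I hx hx1 m).trans
        (pow_le_pow_right₀ (by linarith) hIn)
      rw [nsmul_eq_mul, mul_left_comm]
      refine mul_le_of_le_one_right (by positivity) ?_
      rwa [mul_div_assoc', div_le_one₀ (by positivity), mul_comm])
  simp only [mem_filter, mem_powerset] at hJ
  refine ⟨{v ∈ W₁ | nonNeighbors G I v = J}, (filter_subset _ _).trans (filter_subset _ _), ?_, ?_⟩
  · calc (#W : ℝ) ≤ 2 * #W₁ := hmost
      _ = 2 * ((1 + x) ^ n / x ^ m) * (#W₁ * (x ^ m / (1 + x) ^ n)) := by field_simp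
      _ ≤ _ := by gcongr
  · refine (cliqueFreeOn_card_add_one_of_forall_adj hI hIW hmax hJ.1
      ((filter_subset _ _).trans (filter_subset _ _)) fun v hv u hu huJ ↦ ?_).mono _
      (Nat.succ_le_succ hJ.2)
    rw [← (mem_filter.mp hv).2] at huJ
    by_contra hvu
    exact huJ (mem_filter.mpr ⟨hu, hvu⟩)

/-- The factor by which a vertex set of a dense graph without `n`-cliques may have to shrink before
it contains no clique on more than `m` vertices. The weight `x` is a free parameter: a set of at
most `n` elements has at most `(1 + x) ^ n / x ^ m` subsets of at most `m` elements. -/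
noncomputable def swapLoss (n m : ℕ) (x : ℝ) : ℝ :=
  4 * ((1 + x) ^ n / x ^ m)

theorem one_le_swapLoss (hx : 0 < x) (hx1 : x ≤ 1) : 1 ≤ swapLoss n m x := by
  have h : 1 ≤ (1 + x) ^ n / x ^ m := (one_le_div₀ (by positivity)).mpr
    ((pow_le_one₀ hx.le hx1).trans (one_le_pow₀ (by linarith)))
  rw [swapLoss]
  linarith

theorem exists_subset_cliqueFreeOn_of_sum_card_nonNeighbors_le (hfree : G.CliqueFree n) {δ : ℝ}
    (hδ : 0 < δ) (hsum : ∑ u ∈ W, (#(nonNeighbors G W u) : ℝ) ≤ δ * #W ^ 2)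
    (hm : 8 * δ * n ≤ m + 1) (hx : 0 < x) (hx1 : x ≤ 1) :
    ∃ W' ⊆ W, #W ≤ swapLoss n m x * #W' ∧ G.CliqueFreeOn W' (m + 1) := by
  classical
  obtain rfl | hW := W.eq_empty_or_nonempty
  · exact ⟨∅, subset_rfl, by simp, by simp⟩
  have : (0 : ℝ) < #W := by exact_mod_cast hW.card_pos
  have hhalf := card_le_two_mul_card_filter_lt (s := W)
    (g := fun u ↦ (#(nonNeighbors G W u) : ℝ)) (M := 2 * δ * #W) (by positivity)
    (fun _ _ ↦ by positivity) (by nlinarith)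
  set W₀ : Finset V := {u ∈ W | (#(nonNeighbors G W u) : ℝ) < 2 * δ * #W}
  have hW₀ : W₀ ⊆ W := filter_subset _ _
  obtain ⟨W', hW'W₀, hcard, hW'free⟩ := exists_subset_cliqueFreeOn_of_card_nonNeighbors_le
    (W := W₀) (m := m) (c := 2 * δ * #W) hfree (by positivity)
    (fun u hu ↦ le_trans (by exact_mod_cast card_le_card (filter_subset_filter _ hW₀))
      (mem_filter.mp hu).2.le)
    (calc 2 * (n * (2 * δ * #W)) ≤ 2 * (n * (2 * δ * (2 * (#W₀ : ℝ)))) := by gcongr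
      _ = 8 * δ * n * #W₀ := by ring
      _ ≤ (m + 1) * #W₀ := by gcongr) hx hx1
  refine ⟨W', hW'W₀.trans hW₀, ?_, hW'free⟩
  rw [swapLoss]
  linarith

end Swapping

section ManySparseColors

open Finset

variable {ι V : Type*} {G : ι → SimpleGraph V} {P : Finset ι} {W : Finset V} {d n m : ℕ} {x : ℝ}

theorem OmitsAtMost.sum_sum_card_nonNeighbors_le (hG : OmitsAtMost G P d) (W : Finset V) :
    ∑ i ∈ P, ∑ u ∈ W, #(nonNeighbors (G i) W u) ≤ d * #W ^ 2 + #P * #W := by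
  classical
  calc ∑ i ∈ P, ∑ u ∈ W, #(nonNeighbors (G i) W u)
      = ∑ u ∈ W, ∑ v ∈ W, #(omittedColors G P u v) := by
        rw [sum_comm]
        exact sum_congr rfl fun _ _ ↦ sum_card_nonNeighbors_eq_sum_card_omittedColors G P W _
    _ ≤ ∑ u ∈ W, ∑ v ∈ W, (d + if u = v then #P else 0) := by
        refine sum_le_sum fun u _ ↦ sum_le_sum fun v _ ↦ ?_
        split_ifs with huv
        · exact (card_filter_le _ _).trans (Nat.le_add_left _ _)
        · exact hG huv
    _ = ∑ _u ∈ W, (#W * d + #P) := by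
        refine sum_congr rfl fun u hu ↦ ?_
        rw [sum_add_distrib, sum_const, smul_eq_mul, sum_ite_eq, if_pos hu]
    _ = d * #W ^ 2 + #P * #W := by
        rw [sum_const, smul_eq_mul]
        ring

theorem OmitsAtMost.exists_sum_card_nonNeighbors_le (hG : OmitsAtMost G P d) (hP : P.Nonempty)
    (hW : #P ≤ d * #W) :
    ∃ i ∈ P, #P * ∑ u ∈ W, #(nonNeighbors (G i) W u) ≤ 2 * (d * #W ^ 2) := by
  obtain ⟨i, hi, hmin⟩ := P.exists_min_image (fun i ↦ ∑ u ∈ W, #(nonNeighbors (G i) W u)) hP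
  refine ⟨i, hi, ?_⟩
  calc #P * ∑ u ∈ W, #(nonNeighbors (G i) W u)
      ≤ ∑ i ∈ P, ∑ u ∈ W, #(nonNeighbors (G i) W u) := card_nsmul_le_sum _ _ _ hmin
    _ ≤ d * #W ^ 2 + #P * #W := hG.sum_sum_card_nonNeighbors_le W
    _ ≤ d * #W ^ 2 + d * #W * #W := by gcongr
    _ = 2 * (d * #W ^ 2) := by ring

theorem OmitsAtMost.exists_subset_cliqueFreeOn (hG : OmitsAtMost G P d)
    (hfree : ∀ i ∈ P, (G i).CliqueFree n) (hP : P.Nonempty) (hd : 0 < d)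
    (hm : 16 * d * n ≤ #P * (m + 1)) (hx : 0 < x) (hx1 : x ≤ 1) (hW : #P ≤ d * #W) :
    ∃ i ∈ P, ∃ W' ⊆ W, #W ≤ swapLoss n m x * #W' ∧ (G i).CliqueFreeOn W' (m + 1) := by
  obtain ⟨i, hi, hsum⟩ := hG.exists_sum_card_nonNeighbors_le hP hW
  have hP' : (0 : ℝ) < #P := by exact_mod_cast hP.card_pos
  refine ⟨i, hi, exists_subset_cliqueFreeOn_of_sum_card_nonNeighbors_le (δ := 2 * d / #P)
    (hfree i hi) (by positivity) ?_ ?_ hx hx1⟩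
  · rw [div_mul_eq_mul_div, le_div_iff₀' hP', mul_assoc]
    exact_mod_cast hsum
  · rw [show 8 * (2 * d / #P : ℝ) * n = 16 * d * n / #P by ring, div_le_iff₀' hP']
    exact_mod_cast hm

theorem OmitsAtMost.exists_palette_cliqueFreeOn (hG : OmitsAtMost G P d)
    (hfree : ∀ i ∈ P, (G i).CliqueFree n) (hd : 0 < d) (hm : 32 * d * n ≤ #P * (m + 1))
    (hx : 0 < x) (hx1 : x ≤ 1) {j : ℕ} (hj : 2 * j ≤ #P)
    (hW : swapLoss n m x ^ j * #P ≤ d * #W) :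
    ∃ Q ⊆ P, #Q = j ∧ ∃ W' ⊆ W, #W ≤ swapLoss n m x ^ j * #W' ∧
      ∀ i ∈ Q, (G i).CliqueFreeOn W' (m + 1) := by
  classical
  have hS : 1 ≤ swapLoss n m x := one_le_swapLoss hx hx1
  induction j with
  | zero => exact ⟨∅, empty_subset P, card_empty, W, subset_rfl, by simp, by simp⟩
  | succ j ih =>
    obtain ⟨Q, hQP, hQ, W', hW'W, hcard, hfree'⟩ := ih (by omega)
      (hW.trans' (by gcongr; omega))
    have hPQ : #(P \ Q) = #P - j := by rw [card_sdiff_of_subset hQP, hQ]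
    have hlarge : #(P \ Q) ≤ d * #W' := by
      have hmul : swapLoss n m x ^ j * (#P : ℝ) ≤ swapLoss n m x ^ j * (d * #W') := calc
        swapLoss n m x ^ j * (#P : ℝ) ≤ swapLoss n m x ^ (j + 1) * #P := by gcongr; omega
        _ ≤ d * (swapLoss n m x ^ j * #W') := hW.trans (by gcongr)
        _ = swapLoss n m x ^ j * (d * #W') := by ring
      have hle : #P ≤ d * #W' := by exact_mod_cast le_of_mul_le_mul_left hmul (by positivity)
      omega
    obtain ⟨i, hi, W'', hW'', hcard', hfree''⟩ :=
      (hG.mono_palette sdiff_subset).exists_subset_cliqueFreeOn (m := m)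
        (fun i hi ↦ hfree i (sdiff_subset hi)) (card_pos.mp (by omega)) hd
        (by have : #P * (m + 1) ≤ 2 * #(P \ Q) * (m + 1) := by gcongr; omega
            linarith) hx hx1 hlarge
    obtain ⟨hiP, hiQ⟩ := mem_sdiff.mp hi
    refine ⟨insert i Q, insert_subset hiP hQP, by rw [card_insert_of_notMem hiQ, hQ], W'',
      hW''.trans hW'W, ?_, fun k hk ↦ ?_⟩
    · rw [pow_succ, mul_assoc]
      exact hcard.trans (by gcongr)
    · obtain rfl | hk := mem_insert.mp hk
      · exact hfree''
      · exact (hfree' k hk).subset (G k) (coe_subset.mpr hW'')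

theorem OmitsAtMost.card_lt_of_cliqueFree (hG : OmitsAtMost G P d)
    (hfree : ∀ i ∈ P, (G i).CliqueFree n) (hd : 0 < d) (hdP : 4 * d ≤ #P)
    (hm : 32 * d * n ≤ #P * (m + 1)) (hx : 0 < x) (hx1 : x ≤ 1) :
    (#W : ℝ) < swapLoss n m x ^ (2 * d) * (3 ^ (2 * d * m) * (#P / d)) := by
  have hd' : (0 : ℝ) < d := by exact_mod_cast hd
  have hS : 1 ≤ swapLoss n m x := one_le_swapLoss hx hx1
  by_contra! hle
  have hlarge : swapLoss n m x ^ (2 * d) * #P ≤ d * #W := calc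
    swapLoss n m x ^ (2 * d) * #P ≤ swapLoss n m x ^ (2 * d) * (3 ^ (2 * d * m) * #P) := by
      gcongr
      exact le_mul_of_one_le_left (by positivity) (one_le_pow₀ (by norm_num))
    _ = d * (swapLoss n m x ^ (2 * d) * (3 ^ (2 * d * m) * (#P / d))) := by field_simp
    _ ≤ d * #W := by gcongr
  obtain ⟨Q, hQP, hQ, W', -, hcard, hQfree⟩ :=
    hG.exists_palette_cliqueFreeOn hfree hd hm hx hx1 (by omega) hlarge
  have hW' : (#W' : ℝ) < 3 ^ (2 * d * m) := by
    have hlt := (hG.mono_palette hQP).card_lt_pow_of_cliqueFreeOn (by omega) hQfree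
    rw [hQ, sum_const, hQ, smul_eq_mul] at hlt
    convert hlt using 2
    push_cast
    field_simp
    norm_num
  have hone : (1 : ℝ) ≤ #P / d := (one_le_div₀ hd').mpr (by exact_mod_cast (by omega : d ≤ #P))
  refine hle.not_gt (hcard.trans_lt ?_)
  gcongr
  exact hW'.trans_le (le_mul_of_one_le_right (by positivity) hone)

theorem OmitsAtMost.mul_card_lt_of_cliqueFree (hG : OmitsAtMost G P d)
    (hfree : ∀ i ∈ P, (G i).CliqueFree n) (hP : P.Nonempty) (hd : 0 < d)
    (hn : 16 * d * n ≤ #P) : d * #W < #P := by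
  by_contra! hle
  obtain ⟨i, -, W', -, hcard, hfree'⟩ := hG.exists_subset_cliqueFreeOn (m := 0) (x := 1) hfree hP hd
    (by omega) one_pos le_rfl hle
  rw [cliqueFreeOn_one_iff] at hfree'
  rw [hfree', card_empty, Nat.cast_zero, mul_zero] at hcard
  have hW : #W = 0 := by exact_mod_cast hcard.antisymm (Nat.cast_nonneg _)
  rw [hW, mul_zero] at hle
  exact hP.card_pos.not_ge hle

end ManySparseColors

section UpperBound

open Finset Real

variable {n r s : ℕ}

theorem swapLoss_le_exp (n m : ℕ) {x : ℝ} (hx : 0 < x) :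
    swapLoss n m x ≤ exp (2 + n * x + m * log (1 / x)) := by
  have hfour : (4 : ℝ) ≤ exp 2 := by
    have := exp_one_gt_d9
    rw [show (2 : ℝ) = 1 + 1 by norm_num, exp_add]
    nlinarith
  have hpow : (1 + x) ^ n ≤ exp (n * x) := by
    rw [exp_nat_mul, add_comm]
    exact pow_le_pow_left₀ (by positivity) (add_one_le_exp x) n
  have hinv : exp (m * log (1 / x)) = (x ^ m)⁻¹ := by
    rw [exp_nat_mul, exp_log (by positivity), one_div, inv_pow]
  rw [swapLoss, add_assoc, exp_add, exp_add, hinv, div_eq_mul_inv]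
  gcongr

theorem one_le_log_div {a b : ℝ} (hb : 0 < b) (h : 4 * b ≤ a) : 1 ≤ log (a / b) := by
  rw [le_log_iff_exp_le (div_pos (by linarith) hb), le_div_iff₀ hb]
  nlinarith [exp_one_lt_d9]

theorem OmitsAtMost.card_le_exp {ι V : Type*} {G : ι → SimpleGraph V} {P : Finset ι} {W : Finset V}
    {d : ℕ} (hG : OmitsAtMost G P d) (hfree : ∀ i ∈ P, (G i).CliqueFree n) (hd : 0 < d)
    (hdP : 4 * d ≤ #P) (hn : #P ≤ 32 * d * n) :
    (#W : ℝ) ≤ exp (354 * (n * d ^ 2 / #P * log (#P / d))) := by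
  have hd' : (0 : ℝ) < d := by exact_mod_cast hd
  have hdP' : 4 * (d : ℝ) ≤ #P := by exact_mod_cast hdP
  have hP : (0 : ℝ) < #P := by linarith
  have hL := one_le_log_div hd' hdP'
  have hexpL : exp (log (#P / d)) = #P / d := exp_log (by positivity)
  set L := log (#P / d)
  obtain ⟨y, hy⟩ : ∃ y : ℝ, y = n * (d / #P) := ⟨_, rfl⟩
  have hy32 : 1 ≤ 32 * y := by
    rw [hy, show 32 * (n * (d / #P : ℝ)) = 32 * d * n / #P by ring, le_div_iff₀ hP, one_mul]
    exact_mod_cast hn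
  have hm : ((32 * d * n / #P : ℕ) : ℝ) ≤ 32 * y := by
    refine Nat.cast_div_le.trans_eq ?_
    push_cast
    rw [hy]
    ring
  have hlt := hG.card_lt_of_cliqueFree (W := W) (m := 32 * d * n / #P) (x := d / #P) hfree hd hdP
    (Nat.lt_mul_div_succ _ (by omega)).le (by positivity) ((div_le_one₀ hP).mpr (by linarith))
  set m := 32 * d * n / #P
  have hexponent : (2 * d : ℕ) * (2 + y + m * L) + ((2 * d * m : ℕ) * 2 + L) ≤
      354 * (d * (y * L)) := by
    have hyL : y ≤ y * L := le_mul_of_one_le_right (by linarith) hL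
    have hmL : m * L ≤ 32 * y * L := by gcongr
    have hLd : L ≤ d * (32 * (y * L)) := by
      have hd1 : (1 : ℝ) ≤ d := by exact_mod_cast hd
      nlinarith
    push_cast
    nlinarith
  have hthree : (3 : ℝ) ≤ exp 2 := by linarith [add_one_le_exp (2 : ℝ)]
  calc (#W : ℝ) ≤ swapLoss n m (d / #P) ^ (2 * d) * (3 ^ (2 * d * m) * (#P / d)) := hlt.le
    _ ≤ exp (2 + y + m * L) ^ (2 * d) * (exp 2 ^ (2 * d * m) * exp L) := by
      have hS := swapLoss_le_exp n m (x := d / #P) (by positivity)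
      rw [one_div_div, ← hy] at hS
      have hS0 : 0 ≤ swapLoss n m (d / #P) := by rw [swapLoss]; positivity
      rw [hexpL]
      gcongr
    _ = exp ((2 * d : ℕ) * (2 + y + m * L) + ((2 * d * m : ℕ) * 2 + L)) := by
      rw [← exp_nat_mul, ← exp_nat_mul, ← exp_add, ← exp_add]
    _ ≤ exp (354 * (d * (y * L))) := exp_le_exp.mpr hexponent
    _ = exp (354 * (n * d ^ 2 / #P * L)) := by
      rw [hy]
      ring_nf

/-- The exponent of the upper bounds for `R(n; r, s)`, up to an absolute constant factor. -/
noncomputable def upperExponent (n r s : ℕ) : ℝ :=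
  n * (((r : ℝ) - s) ^ 2 / r) * log (r / min (s : ℝ) (r - s))

theorem two_le_div_min (hs : 1 ≤ s) (hsr : s < r) : (2 : ℝ) ≤ r / min (s : ℝ) (r - s) := by
  have hs' : (0 : ℝ) < s := by exact_mod_cast hs
  have hsr' : (0 : ℝ) < r - s := sub_pos.mpr (by exact_mod_cast hsr)
  rw [le_div_iff₀ (lt_min hs' hsr')]
  linarith [min_le_left (s : ℝ) (r - s), min_le_right (s : ℝ) (r - s)]

theorem upperExponent_nonneg (n : ℕ) (hs : 1 ≤ s) (hsr : s < r) : 0 ≤ upperExponent n r s := by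
  have hlog := log_nonneg (one_le_two.trans (two_le_div_min hs hsr))
  rw [upperExponent]
  positivity

theorem setColoringRamsey_le_exp_of_mul_le (hsr : s < r) (hd : 4 * (r - s) ≤ r)
    (hn : r ≤ 32 * (r - s) * n) :
    (setColoringRamsey n r s : ℝ) ≤ exp (354 * upperExponent n r s) + 1 := by
  have hcast : ((r - s : ℕ) : ℝ) = r - s := Nat.cast_sub hsr.le
  have hmin : min (s : ℝ) (r - s) = r - s :=
    min_eq_right (by rw [← hcast]; exact_mod_cast (by omega : r - s ≤ s))
  refine setColoringRamsey_le_add_one (by positivity) fun {N} G hG hfree ↦ ?_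
  have hle := hG.card_le_exp (W := univ) (fun i _ ↦ hfree i) (by omega)
    (by simpa using hd) (by simpa using hn)
  simp only [card_univ, Fintype.card_fin, hcast] at hle
  rwa [upperExponent, hmin, mul_div_assoc']

theorem setColoringRamsey_le_div_add_one (hsr : s < r) (hn : 16 * (r - s) * n ≤ r) :
    (setColoringRamsey n r s : ℝ) ≤ r / (r - s) + 1 := by
  have hd : (0 : ℝ) < r - s := sub_pos.mpr (by exact_mod_cast hsr)
  have : Nonempty (Fin r) := ⟨⟨s, hsr⟩⟩
  refine setColoringRamsey_le_add_one (by positivity) fun {N} G hG hfree ↦ ?_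
  have hlt := hG.mul_card_lt_of_cliqueFree (W := univ) (fun i _ ↦ hfree i) univ_nonempty
    (by omega) (by simpa using hn)
  rw [card_univ, card_univ, Fintype.card_fin, Fintype.card_fin] at hlt
  rw [le_div_iff₀' hd, ← Nat.cast_sub hsr.le]
  exact_mod_cast hlt.le

theorem setColoringRamsey_le_exp_of_four_mul_le (hsr : s < r) (hd : 4 * (r - s) ≤ r)
    (hnr : (r : ℝ) ≤ n * (r - s) ^ 2) :
    (setColoringRamsey n r s : ℝ) ≤ exp (400 * upperExponent n r s) := by
  have hcast : ((r - s : ℕ) : ℝ) = r - s := Nat.cast_sub hsr.le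
  have hd0 : (0 : ℝ) < r - s := sub_pos.mpr (by exact_mod_cast hsr)
  have hd4 : 4 * ((r : ℝ) - s) ≤ r := by rw [← hcast]; exact_mod_cast hd
  have hr : (0 : ℝ) < r := by linarith
  have hL := one_le_log_div hd0 hd4
  have hLE : log (r / (r - s)) ≤ upperExponent n r s := by
    have hmin : min (s : ℝ) (r - s) = r - s := min_eq_right (by linarith)
    rw [upperExponent, hmin]
    refine le_mul_of_one_le_left (by linarith) ?_
    rwa [mul_div_assoc', one_le_div₀ hr]
  obtain hn | hn := le_total r (32 * (r - s) * n)
  · refine (setColoringRamsey_le_exp_of_mul_le hsr hd hn).trans ?_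
    calc exp (354 * upperExponent n r s) + 1
        ≤ exp (354 * upperExponent n r s) * exp (46 * upperExponent n r s) := by
          have h354 : 1 ≤ exp (354 * upperExponent n r s) := one_le_exp (by linarith)
          have h46 := add_one_le_exp (46 * upperExponent n r s)
          nlinarith
      _ = exp (400 * upperExponent n r s) := by
          rw [← exp_add]
          ring_nf
  · refine (setColoringRamsey_le_div_add_one hsr (by linarith)).trans ?_
    have hrd : 4 ≤ (r : ℝ) / (r - s) := (le_div_iff₀ hd0).mpr hd4
    calc (r : ℝ) / (r - s) + 1 ≤ r / (r - s) * (r / (r - s)) := by nlinarith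
      _ = exp (log (r / (r - s)) + log (r / (r - s))) := by
          rw [exp_add, exp_log (by positivity)]
      _ ≤ exp (400 * upperExponent n r s) := exp_le_exp.mpr (by linarith)

theorem setColoringRamsey_le_exp_of_lt_four_mul (hn : 1 ≤ n) (hs : 1 ≤ s) (hsr : s < r)
    (hd : r < 4 * (r - s)) :
    (setColoringRamsey n r s : ℝ) ≤ exp (32 * upperExponent n r s) := by
  have hs' : (0 : ℝ) < s := by exact_mod_cast hs
  have hsr' : (0 : ℝ) < r - s := sub_pos.mpr (by exact_mod_cast hsr)
  have hr : (0 : ℝ) < r := by linarith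
  have hρ2 := two_le_div_min hs hsr
  have hρs : (r : ℝ) / s ≤ r / min (s : ℝ) (r - s) :=
    div_le_div_of_nonneg_left hr.le (lt_min hs' hsr') (min_le_left _ _)
  rw [upperExponent]
  set ρ := (r : ℝ) / min (s : ℝ) (r - s)
  calc (setColoringRamsey n r s : ℝ) ≤ (1 + r / s) ^ (r * n) :=
        setColoringRamsey_le_pow hn hs hsr.le
    _ ≤ (ρ ^ 2) ^ (r * n) := by
      gcongr
      nlinarith
    _ = exp ((2 * (r * n) : ℕ) * log ρ) := by
      rw [exp_nat_mul, exp_log (by linarith), ← pow_mul]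
    _ ≤ exp (32 * (n * ((r - s) ^ 2 / r) * log ρ)) := by
      have hlog : 0 ≤ log ρ := log_nonneg (by linarith)
      have hr4 : (r : ℝ) ≤ 4 * (r - s) := by
        rw [← Nat.cast_sub hsr.le]
        exact_mod_cast hd.le
      have hr16 : (r : ℝ) ≤ 16 * ((r - s) ^ 2 / r) := by
        rw [mul_div_assoc', le_div_iff₀ hr]
        nlinarith
      rw [exp_le_exp, ← mul_assoc 32]
      gcongr
      push_cast
      calc 2 * ((r : ℝ) * n) ≤ 2 * (16 * ((r - s) ^ 2 / r) * n) := by gcongr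
        _ = 32 * (n * ((r - s) ^ 2 / r)) := by ring

theorem setColoringRamsey_le_exp (hn : 1 ≤ n) (hs : 1 ≤ s) (hsr : s < r)
    (hnr : (r : ℝ) ≤ n * (r - s) ^ 2) :
    (setColoringRamsey n r s : ℝ) ≤ exp (400 * upperExponent n r s) := by
  obtain hd | hd := le_or_gt (4 * (r - s)) r
  · exact setColoringRamsey_le_exp_of_four_mul_le hsr hd hnr
  · refine (setColoringRamsey_le_exp_of_lt_four_mul hn hs hsr hd).trans ?_
    gcongr
    · exact upperExponent_nonneg n hs hsr
    · norm_num

theorem setColoringRamsey_le_mul_exp (hn : 1 ≤ n) (hs : 1 ≤ s) (hsr : s < r) :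
    (setColoringRamsey n r s : ℝ) ≤ (1 + r) ^ (r * r) * exp (400 * upperExponent n r s) := by
  have hE := upperExponent_nonneg n hs hsr
  obtain hnr | hnr := le_or_gt (r : ℝ) (n * (r - s) ^ 2)
  · exact (setColoringRamsey_le_exp hn hs hsr hnr).trans
      (le_mul_of_one_le_left (exp_pos _).le (one_le_pow₀ (by linarith [r.cast_nonneg (α := ℝ)])))
  · have hnr' : n ≤ r := by
      have hd : (1 : ℝ) ≤ r - s := by
        rw [← Nat.cast_sub hsr.le]
        exact_mod_cast Nat.sub_pos_of_lt hsr
      have hle : (n : ℝ) ≤ n * (r - s) ^ 2 :=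
        le_mul_of_one_le_right (by positivity) (one_le_pow₀ hd)
      exact_mod_cast hle.trans hnr.le
    calc (setColoringRamsey n r s : ℝ) ≤ (1 + r / s) ^ (r * n) :=
          setColoringRamsey_le_pow hn hs hsr.le
      _ ≤ (1 + r) ^ (r * r) := by
          have hr0 : (0 : ℝ) ≤ r := r.cast_nonneg
          have hbase : (1 : ℝ) + r / s ≤ 1 + r := by
            gcongr
            exact div_le_self hr0 (by exact_mod_cast hs)
          exact (pow_le_pow_left₀ (by positivity) hbase _).trans
            (pow_le_pow_right₀ (by linarith) (Nat.mul_le_mul_left r hnr'))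
      _ ≤ (1 + r) ^ (r * r) * exp (400 * upperExponent n r s) :=
          le_mul_of_one_le_right (by positivity) (one_le_exp (by linarith))

end UpperBound

section Polychromatic

open Finset

variable {α β τ V : Type*} [Fintype β] [Fintype V] {n : ℕ}

open scoped Classical in
theorem card_filter_forall_ne [Fintype α] (A : Finset α) (b : β) :
    (#{f : α → β | ∀ a ∈ A, f a ≠ b} : ℝ) =
      (1 - 1 / Fintype.card β) ^ #A * Fintype.card β ^ Fintype.card α := by
  have hβ : 0 < Fintype.card β := Fintype.card_pos_iff.mpr ⟨b⟩
  have hpi : ({f : α → β | ∀ a ∈ A, f a ≠ b} : Finset (α → β)) =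
      Fintype.piFinset fun a ↦ if a ∈ A then {b}ᶜ else univ := by
    ext f
    simp only [mem_filter_univ, Fintype.mem_piFinset]
    refine forall_congr' fun a ↦ ?_
    split_ifs with ha <;> simp [ha]
  have hcard (a : α) : #(if a ∈ A then ({b}ᶜ : Finset β) else univ) =
      (if a ∈ A then 1 - 1 / (Fintype.card β : ℝ) else 1) * Fintype.card β := by
    split_ifs
    · rw [card_compl, card_singleton, Nat.cast_pred hβ]
      field_simp
    · rw [card_univ, one_mul]
  rw [hpi, Fintype.card_piFinset, Nat.cast_prod]
  simp_rw [hcard]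
  rw [prod_mul_distrib, prod_ite_mem, univ_inter, prod_const, prod_const, card_univ]

theorem exists_forall_mem_forall_exists_eq [Finite α] [Nonempty β] (T : Finset τ)
    (A : τ → Finset α)
    (hA : (Fintype.card β : ℝ) * ∑ t ∈ T, (1 - 1 / Fintype.card β : ℝ) ^ #(A t) < 1) :
    ∃ f : α → β, ∀ t ∈ T, ∀ b, ∃ a ∈ A t, f a = b := by
  classical
  have := Fintype.ofFinite α
  set bad : Finset (α → β) := (T ×ˢ univ).biUnion fun q ↦ {f | ∀ a ∈ A q.1, f a ≠ q.2}
  have hbad : (#bad : ℝ) < Fintype.card β ^ Fintype.card α := calc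
    (#bad : ℝ) ≤ ∑ q ∈ T ×ˢ (univ : Finset β), (#{f : α → β | ∀ a ∈ A q.1, f a ≠ q.2} : ℝ) := by
      exact_mod_cast card_biUnion_le
    _ = Fintype.card β * (∑ t ∈ T, (1 - 1 / Fintype.card β : ℝ) ^ #(A t)) *
          Fintype.card β ^ Fintype.card α := by
      simp_rw [card_filter_forall_ne, sum_product, sum_const, card_univ, nsmul_eq_mul]
      rw [← mul_sum, ← sum_mul, mul_assoc]
    _ < Fintype.card β ^ Fintype.card α := mul_lt_of_lt_one_left (by positivity) hA
  obtain ⟨f, -, hf⟩ := exists_mem_notMem_of_card_lt_card (s := bad) (t := univ) (by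
    rw [card_univ, Fintype.card_fun]
    exact_mod_cast hbad)
  refine ⟨f, fun t ht b ↦ ?_⟩
  by_contra! hb
  exact hf (mem_biUnion.mpr ⟨(t, b), by simp [ht], by simpa using hb⟩)

theorem exists_omitsAtMost_one_cliqueFree [Nonempty β]
    (h : (Fintype.card β : ℝ) * (((Fintype.card V).choose n : ℕ) *
      (1 - 1 / Fintype.card β : ℝ) ^ n.choose 2) < 1) :
    ∃ G : β → SimpleGraph V, OmitsAtMost G univ 1 ∧ ∀ b, (G b).CliqueFree n := by
  classical
  let edges (S : Finset V) : Finset (Sym2 V) := S.offDiag.image Sym2.mk.uncurry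
  have hedges : ∀ S ∈ powersetCard n (univ : Finset V), #(edges S) = n.choose 2 := fun S hS ↦ by
    rw [← (mem_powersetCard.mp hS).2]
    exact Sym2.card_image_offDiag S
  obtain ⟨f, hf⟩ := exists_forall_mem_forall_exists_eq (β := β) (powersetCard n univ) edges <| by
    rwa [sum_congr rfl fun S hS ↦ by rw [hedges S hS], sum_const, card_powersetCard, card_univ,
      nsmul_eq_mul]
  refine ⟨fun b ↦ SimpleGraph.fromEdgeSet {e | f e ≠ b}, fun u v huv ↦ ?_, fun b S hS ↦ ?_⟩
  · refine card_le_one.mpr fun i hi j hj ↦ ?_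
    simp only [omittedColors, SimpleGraph.fromEdgeSet_adj, Set.mem_ofPred_eq, huv, ne_eq,
      not_false_eq_true, and_true, not_not, mem_filter_univ] at hi hj
    exact hi.symm.trans hj
  · obtain ⟨e, he, hfe⟩ := hf S (by simp [hS.card_eq]) b
    obtain ⟨⟨u, v⟩, huv, rfl⟩ := mem_image.mp he
    rw [mem_offDiag] at huv
    exact ((SimpleGraph.fromEdgeSet_adj _).mp (hS.isClique huv.1 huv.2.1 huv.2.2)).1 hfe

theorem natCast_mul_exp_mul_pow_lt_one {ρ : ℕ} (hρ : 0 < ρ) (hρn : 3 * ρ ≤ n) :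
    (ρ : ℝ) * (Real.exp (n / (6 * ρ)) ^ n * (1 - 1 / ρ : ℝ) ^ n.choose 2) < 1 := by
  have hρ' : (1 : ℝ) ≤ ρ := by exact_mod_cast hρ
  have hρn' : (3 : ℝ) * ρ ≤ n := by exact_mod_cast hρn
  have hbase : 0 ≤ 1 - 1 / (ρ : ℝ) := sub_nonneg.mpr (div_le_one_of_le₀ hρ' (by positivity))
  have hlin : (ρ : ℝ) ≤ Real.exp (ρ - 1) := by linarith [Real.add_one_le_exp ((ρ : ℝ) - 1)]
  calc (ρ : ℝ) * (Real.exp (n / (6 * ρ)) ^ n * (1 - 1 / ρ : ℝ) ^ n.choose 2)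
      ≤ Real.exp (ρ - 1) *
          (Real.exp (n / (6 * ρ)) ^ n * Real.exp (-(1 / (ρ : ℝ))) ^ n.choose 2) := by
        gcongr
        exact Real.one_sub_le_exp_neg _
    _ = Real.exp ((n * n / 6 - n * (n - 1) / 2 + ρ * (ρ - 1)) / ρ) := by
        rw [← Real.exp_nat_mul, ← Real.exp_nat_mul, ← Real.exp_add, ← Real.exp_add,
          Nat.cast_choose_two]
        congr 1
        field_simp
        ring
    _ < 1 := by
        rw [Real.exp_lt_one_iff]
        exact div_neg_of_neg_of_pos (by nlinarith) (by linarith)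

theorem exists_omitsAtMost_one_cliqueFree_of_card_le_exp {ρ : ℕ} (hρ : 0 < ρ) (hρn : 3 * ρ ≤ n)
    (hV : (Fintype.card V : ℝ) ≤ Real.exp (n / (6 * ρ))) :
    ∃ G : Fin ρ → SimpleGraph V, OmitsAtMost G univ 1 ∧ ∀ j, (G j).CliqueFree n := by
  have : Nonempty (Fin ρ) := ⟨⟨0, hρ⟩⟩
  refine exists_omitsAtMost_one_cliqueFree ?_
  rw [Fintype.card_fin]
  refine lt_of_le_of_lt ?_ (natCast_mul_exp_mul_pow_lt_one hρ hρn)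
  have hbase : 0 ≤ 1 - 1 / (ρ : ℝ) :=
    sub_nonneg.mpr (div_le_one_of_le₀ (by exact_mod_cast hρ) (by positivity))
  gcongr
  calc (((Fintype.card V).choose n : ℕ) : ℝ) ≤ (Fintype.card V : ℝ) ^ n := by
        exact_mod_cast Nat.choose_le_pow _ _
    _ ≤ Real.exp (n / (6 * ρ)) ^ n := by gcongr

end Polychromatic

section BlowUpAndCode

open Finset

variable {ι κ μ C V : Type*} {G : ι → SimpleGraph V} {d : ℕ}

theorem cliqueFree_of_hom {H : SimpleGraph C} {K : SimpleGraph V} {n : ℕ} (f : H →g K)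
    (hK : K.CliqueFree n) : H.CliqueFree n := by
  contrapose hK
  rw [SimpleGraph.not_cliqueFree_iff_top_isContained] at hK ⊢
  obtain ⟨φ⟩ := hK
  exact ⟨(f.comp φ.toHom).toCopy (SimpleGraph.Hom.injective_of_top_hom _)⟩

theorem OmitsAtMost.comp [Fintype ι] [DecidableEq ι] [Fintype κ] (hG : OmitsAtMost G univ d)
    {φ : κ → ι} {b : ℕ} (hφ : ∀ i, #{j | φ j = i} ≤ b) : OmitsAtMost (G ∘ φ) univ (b * d) := by
  intro u v huv
  refine (card_le_mul_card_image_of_maps_to (f := φ) (t := omittedColors G univ u v)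
    (fun j hj ↦ ?_) b fun i _ ↦ ?_).trans (Nat.mul_le_mul_left b (hG huv))
  · simpa [omittedColors] using hj
  · exact (card_le_card (filter_subset_filter _ (subset_univ _))).trans (hφ i)

/-- The color classes on the words of a code `w : C → μ → V` obtained by using a separate copy of
the palette of `G` in each position `x : μ`: two words are joined in the color `(x, i)` if their
letters at `x` are joined in the color `i`. -/
def codeColoring (G : ι → SimpleGraph V) (w : C → μ → V) (q : μ × ι) : SimpleGraph C :=
  (G q.2).comap (w · q.1)

open scoped Classical in
theorem omitsAtMost_codeColoring [Fintype ι] [Fintype μ] (hG : OmitsAtMost G univ d)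
    {w : C → μ → V} {k : ℕ} (hw : ∀ ⦃a b⦄, a ≠ b → #{x | w a x = w b x} ≤ k) :
    OmitsAtMost (codeColoring G w) univ (k * Fintype.card ι + Fintype.card μ * d) := by
  intro a b hab
  have hx (x : μ) : #(omittedColors G univ (w a x) (w b x)) ≤
      (if w a x = w b x then Fintype.card ι else 0) + d := by
    split_ifs with h
    · exact (card_le_univ _).trans (Nat.le_add_right _ _)
    · exact (hG h).trans (Nat.le_add_left _ _)
  calc #(omittedColors (codeColoring G w) univ a b)
      = ∑ x, #(omittedColors G univ (w a x) (w b x)) := by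
        simp only [omittedColors, card_filter, Fintype.sum_prod_type, codeColoring,
          SimpleGraph.comap_adj]
    _ ≤ ∑ x, ((if w a x = w b x then Fintype.card ι else 0) + d) := sum_le_sum fun x _ ↦ hx x
    _ = #{x | w a x = w b x} * Fintype.card ι + Fintype.card μ * d := by
        rw [sum_add_distrib, ← sum_filter, sum_const, sum_const, smul_eq_mul, smul_eq_mul,
          card_univ]
    _ ≤ k * Fintype.card ι + Fintype.card μ * d := by gcongr; exact hw hab

open scoped Classical in
theorem exists_code_card_eq_lt {F : Type*} [CommRing F] [IsDomain F] [Fintype μ] {v : μ → F}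
    (hv : Function.Injective v) (k : ℕ) :
    ∃ w : (Fin k → F) → μ → F, ∀ ⦃a b⦄, a ≠ b → #{x | w a x = w b x} < k := by
  refine ⟨fun a x ↦ ((Polynomial.degreeLTEquiv F k).symm a).1.eval (v x), fun a b hab ↦ ?_⟩
  by_contra! hk
  have hdeg (q : Polynomial.degreeLT F k) : q.1.degree < _ :=
    (Polynomial.mem_degreeLT.mp q.2).trans_le (Nat.cast_le.mpr hk)
  exact hab ((Polynomial.degreeLTEquiv F k).symm.injective <| Subtype.ext <|
    Polynomial.eq_of_degrees_lt_of_eval_index_eq _ hv.injOn (hdeg _) (hdeg _)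
      fun x hx ↦ (mem_filter.mp hx).2)

end BlowUpAndCode

section LowerBound

open Finset Real

variable {n r s : ℕ}

theorem card_lt_setColoringRamsey_of_le_exp {V : Type*} [Fintype V] {ρ : ℕ} (hs : 1 ≤ s)
    (hsr : s ≤ r) (hρ : 0 < ρ) (hρn : 3 * ρ ≤ n) (hr : r ≤ ρ * (r - s))
    (hV : (Fintype.card V : ℝ) ≤ exp (n / (6 * ρ))) :
    Fintype.card V < setColoringRamsey n r s := by
  obtain ⟨G, hG, hfree⟩ := exists_omitsAtMost_one_cliqueFree_of_card_le_exp hρ hρn hV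
  obtain ⟨e⟩ : Nonempty (Fin r ↪ Fin ρ × Fin (r - s)) :=
    Function.Embedding.nonempty_of_card_le (by simpa using hr)
  have hfiber (j : Fin ρ) : #{i | (e i).1 = j} ≤ r - s := by
    calc #{i | (e i).1 = j} ≤ #(univ : Finset (Fin (r - s))) :=
          card_le_card_of_injOn (fun i ↦ (e i).2) (fun _ _ ↦ mem_univ _) fun i hi i' hi' h ↦
            e.injective <| Prod.ext
              ((mem_filter_univ i).mp hi |>.trans ((mem_filter_univ i').mp hi').symm) h
      _ = r - s := card_fin _
  refine card_lt_setColoringRamsey (hG.comp hfiber) (fun i ↦ hfree _) (by omega) hs ?_ ?_ <;>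
    rw [Fintype.card_fin]
  omega

theorem card_pow_lt_setColoringRamsey {F : Type*} [Field F] [Fintype F] {ρ m k : ℕ} (hs : 1 ≤ s)
    (hρ : 0 < ρ) (hρn : 3 * ρ ≤ n) (hF : (Fintype.card F : ℝ) ≤ exp (n / (6 * ρ)))
    (hmF : m ≤ Fintype.card F) (hmr : m * ρ ≤ r) (hk : s + (k - 1) * ρ + m ≤ m * ρ) :
    Fintype.card F ^ k < setColoringRamsey n r s := by
  classical
  obtain ⟨G, hG, hfree⟩ := exists_omitsAtMost_one_cliqueFree_of_card_le_exp hρ hρn hF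
  obtain ⟨v⟩ : Nonempty (Fin m ↪ F) := Function.Embedding.nonempty_of_card_le (by simpa using hmF)
  obtain ⟨w, hw⟩ := exists_code_card_eq_lt v.injective k
  have homit := omitsAtMost_codeColoring hG fun a b hab ↦ Nat.le_sub_one_of_lt (hw hab)
  have hlt := card_lt_setColoringRamsey homit
    (fun q ↦ cliqueFree_of_hom (SimpleGraph.Hom.comap (w · q.1) _) (hfree q.2)) (by omega) hs
    (by simpa using hmr) (by simpa [← add_assoc] using hk)
  simpa using hlt

theorem exists_mul_mem_Icc_add (a : ℕ) {d : ℕ} (hd : 0 < d) :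
    ∃ q, 0 < q ∧ q * d ∈ Set.Icc a (a + d) := by
  refine ⟨a / d + 1, Nat.succ_pos _, ?_, ?_⟩
  · rw [mul_comm]
    exact (Nat.lt_mul_div_succ a hd).le
  · rw [add_one_mul]
    exact Nat.add_le_add_right (Nat.div_mul_le_self a d) d

theorem exp_div_le_setColoringRamsey (hs : 1 ≤ s) (hsr : s < r) (hrn : 6 * r ≤ n) :
    exp (n * (((r : ℝ) - s) / r) / 12) ≤ setColoringRamsey n r s := by
  have hd : 0 < r - s := Nat.sub_pos_of_lt hsr
  obtain ⟨ρ, hρ, hrρ, hρd⟩ := exists_mul_mem_Icc_add r hd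
  have hρd' : (ρ : ℝ) * (r - s) ≤ 2 * r := by
    rw [← Nat.cast_sub hsr.le]
    exact_mod_cast hρd.trans (by omega)
  have hρr : ρ ≤ ρ * (r - s) := Nat.le_mul_of_pos_right ρ hd
  have hr : (0 : ℝ) < r := by exact_mod_cast (by omega : 0 < r)
  have : (0 : ℝ) < ρ := by exact_mod_cast hρ
  have hlt := card_lt_setColoringRamsey_of_le_exp (V := Fin ⌊exp (n / (6 * ρ))⌋₊) (n := n) hs
    hsr.le hρ (by omega) hrρ (by rw [Fintype.card_fin]; exact Nat.floor_le (exp_pos _).le)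
  rw [Fintype.card_fin] at hlt
  calc exp (n * (((r : ℝ) - s) / r) / 12) ≤ exp (n / (6 * ρ)) := by
        rw [exp_le_exp, mul_div_assoc', div_div, div_le_div_iff₀ (by positivity) (by positivity)]
        calc (n : ℝ) * (r - s) * (6 * ρ) = 6 * n * (ρ * (r - s)) := by ring
          _ ≤ 6 * n * (2 * r) := by gcongr
          _ = n * (r * 12) := by ring
    _ ≤ (⌊exp (n / (6 * ρ))⌋₊ + 1 : ℕ) := by exact_mod_cast (Nat.lt_floor_add_one _).le
    _ ≤ setColoringRamsey n r s := by exact_mod_cast hlt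

theorem exists_prime_mem_Icc_sq {x : ℝ} (hx : 3 ≤ x) :
    ∃ p : ℕ, p.Prime ∧ (p : ℝ) ∈ Set.Icc x (x ^ 2) := by
  obtain ⟨p, hp, hxp, hpx⟩ := Nat.exists_prime_lt_and_le_two_mul ⌈x⌉₊
    (Nat.ceil_pos.mpr (by linarith)).ne'
  refine ⟨p, hp, (Nat.le_ceil x).trans (by exact_mod_cast hxp.le), ?_⟩
  have hpx' : (p : ℝ) ≤ 2 * ⌈x⌉₊ := by exact_mod_cast hpx
  have hceil := Nat.ceil_lt_add_one (show 0 ≤ x by linarith)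
  nlinarith

theorem exp_mul_le_setColoringRamsey {ρ m k : ℕ} (hs : 1 ≤ s) (hρ : 0 < ρ)
    (hρn : 12 * ρ * (r + 3) ≤ n) (hmr : m * ρ ≤ r) (hk : s + (k - 1) * ρ + m ≤ m * ρ) :
    exp (k * (n / (12 * ρ))) ≤ setColoringRamsey n r s := by
  have : (0 : ℝ) < ρ := by exact_mod_cast hρ
  have hx : (r : ℝ) + 3 ≤ exp (n / (12 * ρ)) := by
    have h : (r : ℝ) + 3 ≤ n / (12 * ρ) := by
      rw [le_div_iff₀' (by positivity)]
      exact_mod_cast hρn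
    linarith [add_one_le_exp ((n : ℝ) / (12 * ρ))]
  obtain ⟨p, hp, hxp, hpx⟩ := exists_prime_mem_Icc_sq
    (le_trans (by linarith [r.cast_nonneg (α := ℝ)]) hx)
  have : Fact p.Prime := ⟨hp⟩
  have hmp : m ≤ p := by
    have hrp : r ≤ p := by exact_mod_cast (by linarith : (r : ℝ) ≤ p)
    exact (Nat.le_mul_of_pos_right m hρ).trans (hmr.trans hrp)
  have hlt := card_pow_lt_setColoringRamsey (F := ZMod p) (n := n) hs hρ (by nlinarith) (by
    rw [ZMod.card]
    refine hpx.trans_eq ?_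
    rw [← exp_nat_mul]
    congr 1
    field_simp
    ring) (by rwa [ZMod.card]) hmr hk
  rw [ZMod.card] at hlt
  calc exp (k * (n / (12 * ρ))) = exp (n / (12 * ρ)) ^ k := exp_nat_mul _ _
    _ ≤ (p : ℝ) ^ k := by gcongr
    _ ≤ setColoringRamsey n r s := by exact_mod_cast hlt.le

theorem exists_code_parameters (hsr : s < r) (hd : 10 * r ≤ (r - s) ^ 2) :
    ∃ ρ m k : ℕ, 0 < ρ ∧ ρ ≤ 5 * r ∧ m * ρ ≤ r ∧ s + (k - 1) * ρ + m ≤ m * ρ ∧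
      (r - s) ^ 3 * ρ ≤ 100 * r ^ 2 * k := by
  obtain ⟨d, hdef⟩ : ∃ d, d = r - s := ⟨_, rfl⟩
  rw [← hdef] at hd ⊢
  have hd0 : 0 < d := by omega
  obtain ⟨ρ, hρ, hρd', hρd⟩ := exists_mul_mem_Icc_add (4 * r) hd0
  replace hρd : ρ * d ≤ 5 * r := by omega
  obtain ⟨m, hm⟩ : ∃ m, m = r / ρ := ⟨_, rfl⟩
  have hmρ : m * ρ ≤ r := hm ▸ Nat.div_mul_le_self r ρ
  have hmρ' : r < (m + 1) * ρ := by
    rw [hm, mul_comm]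
    exact Nat.lt_mul_div_succ r hρ
  have h4m : 4 * m ≤ d := by
    refine Nat.le_of_mul_le_mul_left (?_ : r * (4 * m) ≤ r * d) (by omega)
    calc r * (4 * m) = m * (4 * r) := by ring
      _ ≤ m * (ρ * d) := by gcongr
      _ = m * ρ * d := by ring
      _ ≤ r * d := by gcongr
  obtain ⟨k, hk⟩ : ∃ k, k = d ^ 2 / (10 * r) := ⟨_, rfl⟩
  have hk1 : 1 ≤ k := hk ▸ (Nat.one_le_div_iff (by omega)).mpr hd
  have hkd : k * (10 * r) ≤ d ^ 2 := hk ▸ Nat.div_mul_le_self _ _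
  have hkd' : d ^ 2 ≤ 20 * r * k := by
    have : d ^ 2 < 10 * r * (k + 1) := hk ▸ Nat.lt_mul_div_succ _ (by omega)
    nlinarith
  have h2k : 2 * (k * ρ) ≤ d := by
    refine Nat.le_of_mul_le_mul_left (?_ : 5 * r * d * (2 * (k * ρ)) ≤ 5 * r * d * d)
      (mul_pos (by omega) hd0)
    calc 5 * r * d * (2 * (k * ρ)) = k * (10 * r) * (ρ * d) := by ring
      _ ≤ d ^ 2 * (5 * r) := by gcongr
      _ = 5 * r * d * d := by ring
  -- Rounding `m * ρ` down loses less than `ρ` colors. Together with the losses `m` and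
  -- `(k - 1) * ρ` this has to fit into `d`, and here `m ≤ d / 4` and `k * ρ ≤ d / 2`.
  refine ⟨ρ, m, k, hρ, (Nat.le_mul_of_pos_right ρ hd0).trans hρd, hmρ, ?_, ?_⟩
  · have hkρ : (k - 1) * ρ + ρ = k * ρ := by rw [← add_one_mul, Nat.sub_add_cancel hk1]
    rw [add_one_mul] at hmρ'
    omega
  · calc d ^ 3 * ρ = d ^ 2 * (ρ * d) := by ring
      _ ≤ 20 * r * k * (5 * r) := by gcongr
      _ = 100 * r ^ 2 * k := by ring

theorem exp_pow_three_le_setColoringRamsey (hs : 1 ≤ s) (hsr : s < r)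
    (hrn : 60 * r * (r + 3) ≤ n) (hd : 10 * r ≤ (r - s) ^ 2) :
    exp (n * (((r : ℝ) - s) ^ 3 / r ^ 2) / 1200) ≤ setColoringRamsey n r s := by
  obtain ⟨ρ, m, k, hρ, hρr, hmr, hk, hdk⟩ := exists_code_parameters hsr hd
  have hρn : 12 * ρ * (r + 3) ≤ n := calc
    12 * ρ * (r + 3) ≤ 12 * (5 * r) * (r + 3) := by gcongr
    _ = 60 * r * (r + 3) := by ring
    _ ≤ n := hrn
  refine le_trans ?_ (exp_mul_le_setColoringRamsey hs hρ hρn hmr hk)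
  have : (0 : ℝ) < ρ := by exact_mod_cast hρ
  have hr : (0 : ℝ) < r := by exact_mod_cast (by omega : 0 < r)
  have hdk' : ((r : ℝ) - s) ^ 3 * ρ ≤ 100 * r ^ 2 * k := by
    rw [← Nat.cast_sub hsr.le]
    exact_mod_cast hdk
  rw [exp_le_exp, mul_div_assoc', mul_div_assoc', div_div,
    div_le_div_iff₀ (by positivity) (by positivity)]
  calc (n : ℝ) * (r - s) ^ 3 * (12 * ρ) = 12 * (n : ℝ) * ((r - s) ^ 3 * ρ) := by ring
    _ ≤ 12 * (n : ℝ) * (100 * r ^ 2 * k) := by gcongr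
    _ = (k : ℝ) * n * (r ^ 2 * 1200) := by ring

/-- The exponent of the lower bound on `R(n; r, s)`, up to an absolute constant. -/
noncomputable def lowerExponent (n r s : ℕ) : ℝ :=
  n * max (((r : ℝ) - s) / r) (((r : ℝ) - s) ^ 3 / r ^ 2)

theorem lowerExponent_nonneg (n : ℕ) (hsr : s ≤ r) : 0 ≤ lowerExponent n r s := by
  have hd : (0 : ℝ) ≤ r - s := sub_nonneg.mpr (by exact_mod_cast hsr)
  exact mul_nonneg n.cast_nonneg (le_max_of_le_left (by positivity))

theorem exp_lowerExponent_le_setColoringRamsey (hs : 1 ≤ s) (hsr : s < r)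
    (hrn : 60 * r * (r + 3) ≤ n) :
    exp (lowerExponent n r s / 1200) ≤ setColoringRamsey n r s := by
  have hr : (0 : ℝ) < r := by exact_mod_cast (by omega : 0 < r)
  have hx : 0 < ((r : ℝ) - s) / r := div_pos (sub_pos.mpr (by exact_mod_cast hsr)) hr
  have hcube : ((r : ℝ) - s) ^ 3 / r ^ 2 = (r - s) ^ 2 / r * ((r - s) / r) := by field_simp
  rw [lowerExponent]
  obtain hd | hd := le_or_gt (10 * r) ((r - s) ^ 2)
  · have hone : 1 ≤ ((r : ℝ) - s) ^ 2 / r := by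
      rw [one_le_div₀ hr, ← Nat.cast_sub hsr.le]
      exact_mod_cast (by omega : r ≤ (r - s) ^ 2)
    rw [max_eq_right (hcube ▸ le_mul_of_one_le_left hx.le hone)]
    exact exp_pow_three_le_setColoringRamsey hs hsr hrn hd
  · have hten : ((r : ℝ) - s) ^ 2 / r ≤ 10 := by
      rw [div_le_iff₀ hr, ← Nat.cast_sub hsr.le]
      exact_mod_cast hd.le
    refine le_trans ?_ (exp_div_le_setColoringRamsey hs hsr (by nlinarith))
    have hmax : max (((r : ℝ) - s) / r) ((r - s) ^ 3 / r ^ 2) ≤ 10 * ((r - s) / r) :=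
      max_le (by linarith) (hcube ▸ mul_le_mul_of_nonneg_right hten hx.le)
    rw [exp_le_exp]
    calc (n : ℝ) * max (((r : ℝ) - s) / r) ((r - s) ^ 3 / r ^ 2) / 1200
        ≤ n * (10 * ((r - s) / r)) / 1200 := by gcongr
      _ = n * ((r - s) / r) / 12 / 10 := by ring
      _ ≤ n * ((r - s) / r) / 12 := div_le_self (by positivity) (by norm_num)

end LowerBound

section PowersOfTwo

open Real

variable {n r s : ℕ}

theorem two_rpow_le_exp {x : ℝ} (hx : 0 ≤ x) : (2 : ℝ) ^ x ≤ exp x := by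
  rw [← exp_one_rpow x]
  exact rpow_le_rpow zero_le_two (by linarith [exp_one_gt_d9]) hx

theorem exp_le_two_rpow_two_mul {x : ℝ} (hx : 0 ≤ x) : exp x ≤ (2 : ℝ) ^ (2 * x) := by
  rw [rpow_mul zero_le_two, ← exp_one_rpow x]
  refine rpow_le_rpow (exp_pos _).le ?_ hx
  norm_num
  linarith [exp_one_lt_d9]

theorem lowerExponent_le (n : ℕ) (hsr : s ≤ r) : lowerExponent n r s ≤ n * r := by
  have hd0 : (0 : ℝ) ≤ r - s := sub_nonneg.mpr (by exact_mod_cast hsr)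
  have hdr : (r : ℝ) - s ≤ r := sub_le_self _ s.cast_nonneg
  rw [lowerExponent]
  gcongr
  obtain rfl | hr := r.eq_zero_or_pos
  · simp
  have hr1 : (1 : ℝ) ≤ r := by exact_mod_cast hr
  refine max_le ((div_le_self hd0 hr1).trans hdr) ?_
  rw [div_le_iff₀ (by positivity), ← pow_succ']
  exact pow_le_pow_left₀ hd0 hdr 3

theorem pow_three_mul_le_lowerExponent {ε : ℝ} (hε : 0 ≤ ε) (n : ℕ) (hr : 0 < r)
    (hsr : (s : ℝ) ≤ (1 - ε) * r) : ε ^ 3 * (n * r) ≤ lowerExponent n r s := by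
  rw [lowerExponent, mul_left_comm]
  gcongr
  refine le_max_of_le_right ?_
  rw [le_div_iff₀ (by positivity)]
  calc ε ^ 3 * r * (r : ℝ) ^ 2 = (ε * r) ^ 3 := by ring
    _ ≤ ((r : ℝ) - s) ^ 3 := pow_le_pow_left₀ (by positivity) (by linarith) 3

theorem two_rpow_le_setColoringRamsey {x : ℝ} (hs : 1 ≤ s) (hsr : s < r)
    (hrn : 60 * r * (r + 3) ≤ n) (hx : x ≤ 1 / 1200 * lowerExponent n r s) :
    (2 : ℝ) ^ x ≤ setColoringRamsey n r s := by
  have hE := lowerExponent_nonneg n hsr.le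
  calc (2 : ℝ) ^ x ≤ 2 ^ (lowerExponent n r s / 1200) :=
        rpow_le_rpow_of_exponent_le one_le_two (by linarith)
    _ ≤ exp (lowerExponent n r s / 1200) := two_rpow_le_exp (by positivity)
    _ ≤ setColoringRamsey n r s := exp_lowerExponent_le_setColoringRamsey hs hsr hrn

theorem two_rpow_neg_mul_le_setColoringRamsey (hn : 1 ≤ n) (hs : 1 ≤ s) (hsr : s < r) :
    (2 : ℝ) ^ (-(60 * r * (r + 3) * r) : ℝ) * 2 ^ (1 / 1200 * lowerExponent n r s) ≤
      setColoringRamsey n r s := by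
  rw [← rpow_add two_pos]
  obtain hrn | hrn := le_or_gt (60 * r * (r + 3)) n
  · exact two_rpow_le_setColoringRamsey hs hsr hrn (add_le_of_nonpos_left (by
      rw [neg_nonpos]
      positivity))
  · have hR : (1 : ℝ) ≤ setColoringRamsey n r s := by
      exact_mod_cast (Nat.sInf_mem (exists_forall_hasMonochromaticClique hn hs hsr.le)).1
    refine (rpow_le_one_of_one_le_of_nonpos one_le_two ?_).trans hR
    have hnr : (n : ℝ) * r ≤ 60 * r * (r + 3) * r := by
      gcongr
      exact_mod_cast hrn.le
    linarith [lowerExponent_le n hsr.le, lowerExponent_nonneg n hsr.le]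

theorem setColoringRamsey_le_two_rpow_logb {ε : ℝ} (hε : 0 < ε) (hn : 1 ≤ n) (hs : 1 ≤ s)
    (hsr : s ≤ r) (hεs : ε * r ≤ s) :
    (setColoringRamsey n r s : ℝ) ≤ 2 ^ (logb 2 (1 + 1 / ε) * n * r) := by
  have hs' : (0 : ℝ) < s := by exact_mod_cast hs
  have hdiv : (r : ℝ) / s ≤ 1 / ε := by
    rw [div_le_div_iff₀ hs' hε]
    linarith
  calc (setColoringRamsey n r s : ℝ) ≤ (1 + r / s) ^ (r * n) := setColoringRamsey_le_pow hn hs hsr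
    _ ≤ (1 + 1 / ε) ^ (r * n) := by gcongr
    _ = 2 ^ (logb 2 (1 + 1 / ε) * n * r) := by
      rw [mul_assoc, rpow_mul zero_le_two, rpow_logb two_pos (by norm_num) (by positivity),
        ← rpow_natCast]
      push_cast
      rw [mul_comm (r : ℝ)]

end PowersOfTwo

theorem theorem1 :
    (∃ c : ℝ, 0 < c ∧ ∃ c' : ℝ, 0 < c' ∧ ∃ a b : ℕ → ℝ, (∀ r, 0 < a r) ∧ (∀ r, 0 < b r) ∧
      ∀ n r s : ℕ, 3 ≤ n → 1 ≤ s → s < r →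
        -- lower bound
        a r * (2 : ℝ) ^ (c * (n : ℝ) * max (((r : ℝ) - s) / r) (((r : ℝ) - s) ^ 3 / (r : ℝ) ^ 2))
            ≤ (setColoringRamsey n r s : ℝ) ∧
        -- upper bound
        ((r : ℝ) ≤ (n : ℝ) * ((r : ℝ) - s) ^ 2 →
          (setColoringRamsey n r s : ℝ) ≤
            (2 : ℝ) ^ (c' * (n : ℝ) * (((r : ℝ) - s) ^ 2 / r) *
              Real.log ((r : ℝ) / min (s : ℝ) ((r : ℝ) - s)))) ∧
        -- upper bound for all parameters, up to a factor that depends only on `r`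
        (setColoringRamsey n r s : ℝ) ≤
            b r * (2 : ℝ) ^ (c' * (n : ℝ) * (((r : ℝ) - s) ^ 2 / r) *
              Real.log ((r : ℝ) / min (s : ℝ) ((r : ℝ) - s)))) ∧
    -- the exponent is of order `n * r` if `s / r` is bounded away from `0` and `1`
    (∀ ε : ℝ, 0 < ε → ∃ c₁ : ℝ, 0 < c₁ ∧ ∃ c₂ : ℝ, 0 < c₂ ∧ ∃ n₀ : ℕ → ℕ,
      ∀ n r s : ℕ, 3 ≤ n → ε * r < s → (s : ℝ) < (1 - ε) * r →
        (n₀ r ≤ n → (2 : ℝ) ^ (c₁ * (n : ℝ) * r) ≤ (setColoringRamsey n r s : ℝ)) ∧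
        (setColoringRamsey n r s : ℝ) ≤ (2 : ℝ) ^ (c₂ * (n : ℝ) * r)) := by
  refine ⟨⟨1 / 1200, by norm_num, 800, by norm_num, fun r ↦ 2 ^ (-(60 * r * (r + 3) * r) : ℝ),
    fun r ↦ (1 + r) ^ (r * r), fun r ↦ by positivity, fun r ↦ by positivity,
    fun n r s hn hs hsr ↦ ?_⟩, fun ε hε ↦ ?_⟩
  · have hn1 : 1 ≤ n := by omega
    have hlower := two_rpow_neg_mul_le_setColoringRamsey hn1 hs hsr
    have hupper : Real.exp (400 * upperExponent n r s) ≤ 2 ^ (800 * upperExponent n r s) :=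
      (exp_le_two_rpow_two_mul (by linarith [upperExponent_nonneg n hs hsr])).trans_eq (by ring_nf)
    simp only [lowerExponent, upperExponent, ← mul_assoc] at hlower hupper
    refine ⟨hlower, fun hnr ↦ (setColoringRamsey_le_exp hn1 hs hsr hnr).trans ?_,
      (setColoringRamsey_le_mul_exp hn1 hs hsr).trans ?_⟩
    · simpa only [upperExponent, ← mul_assoc] using hupper
    · simp only [upperExponent, ← mul_assoc]
      gcongr
  · refine ⟨ε ^ 3 / 1200, by positivity, Real.logb 2 (1 + 1 / ε),
      Real.logb_pos one_lt_two (lt_add_of_pos_right 1 (by positivity)),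
      fun r ↦ 60 * r * (r + 3), fun n r s hn hεs hsε ↦ ?_⟩
    have hεr : (0 : ℝ) ≤ ε * r := by positivity
    have hs : 1 ≤ s := by exact_mod_cast hεr.trans_lt hεs
    have hsr : s < r := by exact_mod_cast (by linarith : (s : ℝ) < r)
    refine ⟨fun hn₀ ↦ two_rpow_le_setColoringRamsey hs hsr hn₀ ?_,
      setColoringRamsey_le_two_rpow_logb hε (by omega) hs hsr.le hεs.le⟩
    linarith [pow_three_mul_le_lowerExponent hε.le n (by omega) hsε.le]
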